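/- For integers $k\ge 1$ and $n\ge 1$ let $d_k(n)$ be the number of ordered $k$-tuples of positive integers with product $n$, and for $x>0$ put $$\Delta_k(x)=\sum_{n\le x}d_k(n)-\operatorname*{Res}_{s=1}\left(\zeta(s)^k\,\frac{x^s}{s}\right),$$ where $\zeta$ is the Riemann zeta function (the residue has the form $xP_k(\log x)$ with $P_k$ a polynomial of degree $k-1$). Let $$D_k(s)=\sum_{n=1}^{\infty}\frac{\Delta_k(n)}{n^s},$$ a Dirichlet series that converges absolutely for $\operatorname{Re} s>2$. Then, for every $k\ge 1$, the function $D_k(s)$, defined by the series on its open half-plane of absolute convergence, can be continued to a meromorphic function on the whole complex plane, and this function is holomorphic at every point other than $s=1,0,-1,-2,\dots$; that is, its poles lie only among these points. -/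

import Mathlib

open scoped Topology

noncomputable section

namespace PiltzDivisor

/-- The Piltz divisor function `d_k(n)`: the number of ways to write `n ≥ 1` as an ordered product
of `k` positive integers. -/
def d (k n : ℕ) : ℕ := (Nat.finMulAntidiag k n).card

/-- The residue at `c` of a function `f` with an isolated singularity at `c`: the value of
`(2πi)⁻¹ ∮ f(z) dz` over the circle `|z - c| = r` for all small `r > 0`, taken as the limit as
`r → 0⁺` (the integral does not depend on `r` once `r` is small). -/
def residue (f : ℂ → ℂ) (c : ℂ) : ℂ :=
  Filter.limUnder (𝓝[>] (0 : ℝ)) fun r : ℝ =>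
    (2 * (Real.pi : ℂ) * Complex.I)⁻¹ * ∮ z in C(c, r), f z

/-- The main term `x P_k(log x)`, for `x > 0`, which is by definition the residue of
`ζ(s)^k x^s / s` at `s = 1`. -/
def mainTerm (k : ℕ) (x : ℝ) : ℂ :=
  residue (fun s : ℂ => riemannZeta s ^ k * (x : ℂ) ^ s / s) 1

/-- The error term `Δ_k(x) = ∑_{n ≤ x} d_k(n) - x P_k(log x)`. -/
def Delta (k : ℕ) (x : ℝ) : ℂ :=
  (∑ n ∈ Finset.Icc 1 ⌊x⌋₊, (d k n : ℂ)) - mainTerm k x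

end PiltzDivisor

end

namespace PiltzDivisor

open Complex Filter

/-! Let A(n) be the summatory function of d_k. Summation by parts gives ζ(s)^k = ∑ A(n) (n^{-s} -
(n+1)^{-s}) for large Re s. Expanding (n+1)^{-s} = n^{-s} (1 + 1/n)^{-s} binomially to finite order
yields (`mul_LSeries_dSum`) s L(A, s+1) = ζ(s)^k + (entire coefficients times L(A, s+2), L(A, s+3),
…) + remainder, where the remainder is holomorphic in a half-plane reaching further left as the
order grows. Hence L(A, s) - ζ(s-1)^k/(s-1) continues one unit to the left at a time. Division by s
- 1 and the left shifts of ζ(w)^k/w create poles only at 1, 0, -1, …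
(`exists_continuation_halfPlane`).

The main term is n ∑ a_i (log n)^i / i!, where the a_i are the polar coefficients of ζ(w)^k/w at w =
1. Its Dirichlet series at s therefore has, in w = s - 1, the same principal part at w = 1 as
ζ(w)^k/w (`exists_mainTerm_eq`). So the pole at s = 2 cancels, and this difference contributes at
most a pole at s = 1. -/

/-! ### Binomial expansion of (1 + x)^{-s} with remainder -/

/-- The coefficient of `x ^ j` in the binomial series of `(1 + x) ^ (-s)`. -/
noncomputable def negBinomCoeff : ℕ → ℂ → ℂ
  | 0, _ => 1
  | j + 1, s => -s * negBinomCoeff j (s + 1) / (j + 1)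

/-- The remainder of the binomial series of `(1 + x) ^ (-s)` after `N` terms. -/
noncomputable def negBinomRem (N : ℕ) (s : ℂ) (x : ℝ) : ℂ :=
  (1 + (x : ℂ)) ^ (-s) - ∑ j ∈ Finset.range N, negBinomCoeff j s * (x : ℂ) ^ j

theorem differentiable_negBinomCoeff (j : ℕ) : Differentiable ℂ (negBinomCoeff j) := by
  induction j with
  | zero => exact differentiable_const _
  | succ j ih =>
    change Differentiable ℂ fun s => -s * negBinomCoeff j (s + 1) / (j + 1)
    have : Differentiable ℂ fun s : ℂ => negBinomCoeff j (s + 1) :=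
      ih.comp (differentiable_id.add_const 1)
    fun_prop

theorem one_add_ofReal_mem_slitPlane {x : ℝ} (hx : 0 ≤ x) : (1 + (x : ℂ)) ∈ slitPlane := by
  left
  simp
  linarith

theorem differentiable_negBinomRem (N : ℕ) {x : ℝ} (hx : 0 ≤ x) :
    Differentiable ℂ fun s => negBinomRem N s x := by
  have h0 : (1 + (x : ℂ)) ≠ 0 := slitPlane_ne_zero (one_add_ofReal_mem_slitPlane hx)
  have h1 : Differentiable ℂ fun s : ℂ => (1 + (x : ℂ)) ^ (-s) := fun s =>
    (differentiableAt_id.neg).const_cpow (Or.inl h0)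
  refine h1.sub ?_
  refine Differentiable.fun_sum fun j _ => ?_
  exact (differentiable_negBinomCoeff j).mul_const _

/-- The recursion for `negBinomCoeff` is exactly what makes termwise differentiation match d/dx
(1+x)^{-s} = -s (1+x)^{-(s+1)}, so no closed form of the coefficients is needed. -/
theorem hasDerivAt_negBinomRem (N : ℕ) (s : ℂ) {x : ℝ} (hx : 0 ≤ x) :
    HasDerivAt (negBinomRem (N + 1) s) (-s * negBinomRem N (s + 1) x) x := by
  have h1 : HasDerivAt (fun z : ℂ => (1 + z) ^ (-s)) (-s * (1 + (x : ℂ)) ^ (-s - 1) * 1) (x : ℂ) :=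
    ((hasDerivAt_id (x : ℂ)).const_add 1).cpow_const (one_add_ofReal_mem_slitPlane hx)
  have h2 : HasDerivAt (fun z : ℂ => ∑ j ∈ Finset.range (N + 1), negBinomCoeff j s * z ^ j)
      (∑ j ∈ Finset.range (N + 1), negBinomCoeff j s * (j * (x : ℂ) ^ (j - 1))) (x : ℂ) :=
    HasDerivAt.fun_sum fun j _ => (hasDerivAt_pow j (x : ℂ)).const_mul _
  have h3 := (h1.sub h2).comp_ofReal
  refine h3.congr_deriv ?_
  rw [Finset.sum_range_succ', negBinomRem, mul_sub, Finset.mul_sum]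
  have e : -s - 1 = -(s + 1) := by ring
  simp only [Nat.cast_zero, zero_mul, mul_zero, add_zero, mul_one, e]
  congr 1
  refine Finset.sum_congr rfl fun j _ => ?_
  have : ((j : ℂ) + 1) ≠ 0 := by exact_mod_cast j.succ_ne_zero
  simp only [negBinomCoeff, Nat.add_sub_cancel, Nat.cast_add, Nat.cast_one]
  field_simp

/-- Induction by the mean value inequality on [0, x], since the remainder vanishes at 0 once N ≥ 1.
The derivative lives at s + 1, so the radius B must vary in the induction. Uniformity in s over a
disc is what later gives holomorphy of the remainder series. -/
theorem exists_norm_negBinomRem_le (N : ℕ) (B : ℝ) : ∃ C : ℝ, 0 ≤ C ∧ ∀ s : ℂ, ‖s‖ ≤ B →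
    ∀ x : ℝ, 0 ≤ x → x ≤ 1 → ‖negBinomRem N s x‖ ≤ C * x ^ N := by
  induction N generalizing B with
  | zero =>
    refine ⟨2 ^ |B|, by positivity, fun s hs x hx hx1 => ?_⟩
    have h : (1 + (x : ℂ)) = ((1 + x : ℝ) : ℂ) := by push_cast; rfl
    simp only [negBinomRem, Finset.range_zero, Finset.sum_empty, sub_zero, pow_zero, mul_one]
    rw [h, norm_cpow_eq_rpow_re_of_pos (by linarith)]
    calc (1 + x) ^ (-s).re ≤ (1 + x) ^ |B| := by
          refine Real.rpow_le_rpow_of_exponent_le (by linarith) ?_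
          calc (-s).re ≤ ‖-s‖ := re_le_norm _
            _ = ‖s‖ := norm_neg s
            _ ≤ |B| := hs.trans (le_abs_self B)
      _ ≤ 2 ^ |B| := Real.rpow_le_rpow (by linarith) (by linarith) (abs_nonneg B)
  | succ N ih =>
    obtain ⟨C, hC0, hC⟩ := ih (B + 1)
    refine ⟨|B| * C, by positivity, fun s hs x hx hx1 => ?_⟩
    have key := (convex_Icc (0 : ℝ) x).norm_image_sub_le_of_norm_hasDerivWithin_le
      (f := negBinomRem (N + 1) s) (f' := fun y => -s * negBinomRem N (s + 1) y)
      (C := |B| * C * x ^ N)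
      (fun y hy => (hasDerivAt_negBinomRem N s hy.1).hasDerivWithinAt)
      (fun y hy => by
        rw [norm_mul, norm_neg, mul_assoc]
        refine mul_le_mul (hs.trans (le_abs_self B)) ?_ (norm_nonneg _) (abs_nonneg B)
        refine (hC (s + 1) ?_ y hy.1 (hy.2.trans hx1)).trans ?_
        · exact (norm_add_le _ _).trans (by simpa using hs)
        · exact mul_le_mul_of_nonneg_left (pow_le_pow_left₀ hy.1 hy.2 N) hC0)
      (Set.left_mem_Icc.2 hx) (Set.right_mem_Icc.2 hx)
    have h0 : negBinomRem (N + 1) s 0 = 0 := by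
      simp [negBinomRem, Finset.sum_range_succ', negBinomCoeff]
    rw [h0, sub_zero, sub_zero, Real.norm_of_nonneg hx] at key
    rw [pow_succ, ← mul_assoc]
    exact key

/-! ### Dirichlet series of the remainders -/

/-- The Dirichlet series `∑ A(n) r_N(s, 1/n) n^{-s}`, where `r_N` is the remainder of the
binomial series. -/
noncomputable def remSeries (A : ℕ → ℂ) (N : ℕ) (s : ℂ) : ℂ :=
  LSeries (fun n => A n * negBinomRem N s ((n : ℝ)⁻¹)) s

/-- The n-th term is O(n^{2 - N - Re s}); the bound 4 - N on Re s is what makes this O(n^{-2}), a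
summable majorant independent of s in the disc. -/
theorem exists_norm_term_negBinomRem_le {A : ℕ → ℂ} {C : ℝ} (hA : ∀ n, ‖A n‖ ≤ C * (n : ℝ) ^ 2)
    (N : ℕ) (B : ℝ) : ∃ C' : ℝ, ∀ s : ℂ, ‖s‖ ≤ B → 4 - (N : ℝ) < s.re → ∀ n : ℕ,
      ‖LSeries.term (fun n => A n * negBinomRem N s ((n : ℝ)⁻¹)) s n‖ ≤
        C' * ((n : ℝ) ^ 2)⁻¹ := by
  obtain ⟨K, hK0, hK⟩ := exists_norm_negBinomRem_le N B
  refine ⟨C * K, fun s hsB hs n => ?_⟩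
  rcases eq_or_ne n 0 with rfl | hn
  · simp
  have hn0 : 0 < (n : ℝ) := by exact_mod_cast Nat.pos_of_ne_zero hn
  have hn1 : 1 ≤ (n : ℝ) := by exact_mod_cast Nat.one_le_iff_ne_zero.2 hn
  rw [LSeries.norm_term_eq, if_neg hn, norm_mul, div_le_iff₀ (by positivity)]
  have h1 := hK s hsB (n : ℝ)⁻¹ (by positivity) (inv_le_one_of_one_le₀ hn1)
  have h2 : ((n : ℝ) ^ 2) * ((n : ℝ)⁻¹) ^ N ≤ ((n : ℝ) ^ 2)⁻¹ * (n : ℝ) ^ s.re := by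
    rw [← Real.rpow_natCast, ← Real.rpow_natCast, Real.inv_rpow hn0.le, ← Real.rpow_neg hn0.le,
      ← Real.rpow_neg hn0.le, ← Real.rpow_add hn0, ← Real.rpow_add hn0]
    refine Real.rpow_le_rpow_of_exponent_le hn1 ?_
    push_cast
    linarith
  have hC0 : 0 ≤ C := by simpa using (norm_nonneg _).trans (hA 1)
  calc ‖A n‖ * ‖negBinomRem N s (n : ℝ)⁻¹‖ ≤ (C * (n : ℝ) ^ 2) * (K * ((n : ℝ)⁻¹) ^ N) :=
        mul_le_mul (hA n) h1 (norm_nonneg _) (by positivity)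
    _ = C * K * ((n : ℝ) ^ 2 * ((n : ℝ)⁻¹) ^ N) := by ring
    _ ≤ C * K * (((n : ℝ) ^ 2)⁻¹ * (n : ℝ) ^ s.re) :=
        mul_le_mul_of_nonneg_left h2 (by positivity)
    _ = C * K * ((n : ℝ) ^ 2)⁻¹ * (n : ℝ) ^ s.re := by ring

theorem summable_const_mul_inv_sq (C : ℝ) : Summable fun n : ℕ => C * ((n : ℝ) ^ 2)⁻¹ :=
  (Real.summable_nat_pow_inv.2 one_lt_two).mul_left C

theorem summable_term_negBinomRem {A : ℕ → ℂ} {C : ℝ} (hA : ∀ n, ‖A n‖ ≤ C * (n : ℝ) ^ 2)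
    (N : ℕ) {s : ℂ} (hs : 4 - (N : ℝ) < s.re) :
    LSeriesSummable (fun n => A n * negBinomRem N s ((n : ℝ)⁻¹)) s := by
  obtain ⟨C', hC'⟩ := exists_norm_term_negBinomRem_le hA N ‖s‖
  exact Summable.of_norm_bounded (summable_const_mul_inv_sq C') fun n => hC' s le_rfl hs n

theorem analyticAt_remSeries {A : ℕ → ℂ} {C : ℝ} (hA : ∀ n, ‖A n‖ ≤ C * (n : ℝ) ^ 2)
    (N : ℕ) {s : ℂ} (hs : 4 - (N : ℝ) < s.re) : AnalyticAt ℂ (remSeries A N) s := by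
  obtain ⟨C', hC'⟩ := exists_norm_term_negBinomRem_le hA N (‖s‖ + 1)
  have hopen : IsOpen ({z : ℂ | 4 - (N : ℝ) < z.re} ∩ Metric.ball 0 (‖s‖ + 1)) :=
    (isOpen_lt continuous_const continuous_re).inter Metric.isOpen_ball
  have hd : DifferentiableOn ℂ (remSeries A N)
      ({z : ℂ | 4 - (N : ℝ) < z.re} ∩ Metric.ball 0 (‖s‖ + 1)) := by
    refine differentiableOn_tsum_of_summable_norm (summable_const_mul_inv_sq C') ?_ hopen ?_
    · intro n
      rcases eq_or_ne n 0 with rfl | hn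
      · simp only [LSeries.term_zero]; exact differentiableOn_const _
      · have h1 : Differentiable ℂ fun z : ℂ =>
            A n * negBinomRem N z ((n : ℝ)⁻¹) * (n : ℂ) ^ (-z) :=
          ((differentiable_negBinomRem N (by positivity)).const_mul _).mul fun z =>
            (differentiableAt_id.neg).const_cpow (Or.inl (by exact_mod_cast hn))
        refine h1.differentiableOn.congr fun z _ => ?_
        rw [LSeries.term_of_ne_zero hn, cpow_neg, div_eq_mul_inv]
    · intro n z hz
      exact hC' z (by simpa using (mem_ball_zero_iff.1 hz.2).le) hz.1 n
  exact hd.analyticAt (hopen.mem_nhds ⟨hs, by simp⟩)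

/-! ### Summation by parts -/

theorem LSeriesSummable_of_norm_le_sq {A : ℕ → ℂ} {C : ℝ} (hA : ∀ n, ‖A n‖ ≤ C * (n : ℝ) ^ 2)
    {s : ℂ} (hs : 3 < s.re) : LSeriesSummable A s := by
  refine LSeriesSummable_of_le_const_mul_rpow (x := 3) hs ⟨C, fun n _ => ?_⟩
  have := hA n
  rw [← Real.rpow_natCast] at this
  norm_num at this ⊢
  exact this

theorem term_shift_eq {A : ℕ → ℂ} (hA0 : A 0 = 0) (J : ℕ) (s : ℂ) (n : ℕ) :
    LSeries.term (fun m => A (m - 1)) s (n + 1) =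
      (∑ j ∈ Finset.range J, negBinomCoeff j s * LSeries.term A (s + j) n) +
        LSeries.term (fun n => A n * negBinomRem J s ((n : ℝ)⁻¹)) s n := by
  rcases eq_or_ne n 0 with rfl | hn
  · simp [LSeries.term_of_ne_zero, hA0]
  have hn0 : (n : ℂ) ≠ 0 := by exact_mod_cast hn
  have hpos : 0 < (n : ℝ) := by exact_mod_cast Nat.pos_of_ne_zero hn
  have h1 : ((n + 1 : ℕ) : ℂ) ^ (-s) = (n : ℂ) ^ (-s) * (1 + ((n : ℝ)⁻¹ : ℝ)) ^ (-s) := by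
    have : ((n + 1 : ℕ) : ℂ) = ((n : ℝ) : ℂ) * ((1 + (n : ℝ)⁻¹ : ℝ) : ℂ) := by
      push_cast
      field_simp
    rw [this, mul_cpow_ofReal_nonneg hpos.le (by positivity)]
    push_cast
    rfl
  have h2 : (1 + (((n : ℝ)⁻¹ : ℝ) : ℂ)) ^ (-s) =
      ∑ j ∈ Finset.range J, negBinomCoeff j s * (((n : ℝ)⁻¹ : ℝ) : ℂ) ^ j +
        negBinomRem J s ((n : ℝ)⁻¹) := by
    rw [negBinomRem]; ring
  rw [LSeries.term_of_ne_zero n.succ_ne_zero, LSeries.term_of_ne_zero hn, div_eq_mul_inv,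
    ← cpow_neg, h1, h2, Nat.succ_sub_one, mul_add, mul_add, Finset.mul_sum, Finset.mul_sum]
  congr 1
  · refine Finset.sum_congr rfl fun j _ => ?_
    rw [LSeries.term_of_ne_zero hn, div_eq_mul_inv, ← cpow_neg, neg_add, cpow_add _ _ hn0,
      cpow_neg _ (j : ℂ), cpow_natCast]
    push_cast
    rw [inv_pow]
    ring
  · rw [div_eq_mul_inv, ← cpow_neg]
    ring

/-- Summation by parts combined with the binomial expansion of `(n + 1) ^ (-s)`: the Dirichlet
series of a sequence in terms of that of its partial sums. -/
theorem mul_LSeries_partialSum {A : ℕ → ℂ} {C : ℝ} (hA : ∀ n, ‖A n‖ ≤ C * (n : ℝ) ^ 2)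
    (J : ℕ) {s : ℂ} (hs : 3 < s.re) :
    s * LSeries A (s + 1) = LSeries (fun n => A n - A (n - 1)) s +
      ∑ i ∈ Finset.range J, negBinomCoeff (i + 2) s * LSeries A (s + i + 2) +
        remSeries A (J + 2) s := by
  have hA0 : A 0 = 0 := by simpa using hA 0
  have hsum (j : ℕ) : LSeriesSummable A (s + j) :=
    LSeriesSummable_of_norm_le_sq hA (by
      have : (0 : ℝ) ≤ j := j.cast_nonneg
      simp only [add_re, natCast_re]; linarith)
  have hrem : LSeriesSummable (fun n => A n * negBinomRem (J + 2) s ((n : ℝ)⁻¹)) s :=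
    summable_term_negBinomRem hA (J + 2) (by
      have : (0 : ℝ) ≤ J := J.cast_nonneg
      push_cast; linarith)
  have h1 : HasSum (fun n => LSeries.term (fun m => A (m - 1)) s (n + 1))
      (∑ j ∈ Finset.range (J + 2), negBinomCoeff j s * LSeries A (s + j) +
        remSeries A (J + 2) s) := by
    have := (hasSum_sum (s := Finset.range (J + 2)) fun j _ =>
      (hsum j).hasSum.mul_left (negBinomCoeff j s)).add hrem.hasSum
    simp only [term_shift_eq hA0 (J + 2)]
    exact this
  have h2 : LSeriesHasSum (fun m => A (m - 1)) s
      (∑ j ∈ Finset.range (J + 2), negBinomCoeff j s * LSeries A (s + j) +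
        remSeries A (J + 2) s) := by
    have := (hasSum_nat_add_iff (f := LSeries.term (fun m => A (m - 1)) s) 1).1 h1
    simpa only [LSeriesHasSum, Finset.sum_range_one, LSeries.term_zero, add_zero] using this
  have hs0 : LSeriesSummable A s := by simpa using hsum 0
  have h3 := (hs0.LSeriesHasSum.sub h2).LSeries_eq
  have h4 : (A - fun m => A (m - 1)) = fun n => A n - A (n - 1) := rfl
  -- Two terms are peeled off: j = 0 cancels L(A, s), and j = 1, with coefficient -s, becomes the
  -- left-hand side.
  rw [h4, Finset.sum_range_succ', Finset.sum_range_succ'] at h3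
  simp only [negBinomCoeff, Nat.cast_zero, Nat.cast_add, Nat.cast_one, add_zero, zero_add] at h3
  rw [h3]
  have h5 : ∀ i : ℕ, s + ((i : ℂ) + 1 + 1) = s + i + 2 := fun i => by ring
  simp only [negBinomCoeff, h5, Nat.cast_add, Nat.cast_one]
  ring

/-! ### Identity theorem and gluing of continuations -/

/-- If f - g had finite order at z, it would have finite order throughout the preconnected set U,
contradicting its vanishing near z₀. Only punctured neighbourhoods appear because values at poles
are arbitrary. -/
theorem eventuallyEq_nhdsNE_of_isPreconnected {f g : ℂ → ℂ} {U : Set ℂ} (hU : IsPreconnected U)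
    (hf : MeromorphicOn f U) (hg : MeromorphicOn g U) {z₀ z : ℂ} (hz₀ : z₀ ∈ U) (hz : z ∈ U)
    (h : f =ᶠ[𝓝[≠] z₀] g) : f =ᶠ[𝓝[≠] z] g := by
  have hfg : MeromorphicOn (f - g) U := hf.sub hg
  by_contra hne
  have h1 : meromorphicOrderAt (f - g) z ≠ ⊤ := by
    rw [Ne, meromorphicOrderAt_eq_top_iff]
    intro h2
    exact hne (h2.mono fun w hw => sub_eq_zero.1 hw)
  refine hfg.meromorphicOrderAt_ne_top_of_isPreconnected hU hz hz₀ h1 ?_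
  rw [meromorphicOrderAt_eq_top_iff]
  exact h.mono fun w hw => sub_eq_zero.2 hw

theorem _root_.AnalyticAt.eventuallyEq_nhds_of_nhdsNE {f g : ℂ → ℂ} {z : ℂ} (hf : AnalyticAt ℂ f z)
    (hg : AnalyticAt ℂ g z) (h : f =ᶠ[𝓝[≠] z] g) : f =ᶠ[𝓝 z] g :=
  (hf.continuousAt.eventuallyEq_nhds_iff_eventuallyEq_nhdsNE hg.continuousAt).1 h

theorem isPreconnected_re_gt (c : ℝ) : IsPreconnected {z : ℂ | c < z.re} :=
  (convex_halfSpace_re_gt c).isPreconnected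

/-- Continuations to the half-planes `Re s > c - N` fit together to a continuation to `ℂ`. -/
theorem exists_meromorphic_of_forall_halfPlane {f : ℂ → ℂ} {c : ℝ} {P : Set ℂ}
    (hP : ∀ z, ∀ᶠ w in 𝓝[≠] z, w ∉ P)
    (h : ∀ N : ℕ, ∃ G : ℂ → ℂ, (∀ s, c - N < s.re → MeromorphicAt G s) ∧
      (∀ s, c - N < s.re → s ∉ P → AnalyticAt ℂ G s) ∧ ∀ s, c < s.re → G s = f s) :
    ∃ G : ℂ → ℂ, Meromorphic G ∧ (∀ s, s ∉ P → AnalyticAt ℂ G s) ∧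
      ∀ s, c < s.re → G s = f s := by
  choose G hmer han heq using h
  have key : ∀ M N : ℕ, ∀ s : ℂ, c - M < s.re → c - N < s.re → s ∉ P → G M s = G N s := by
    intro M N s hM hN hs
    have hpre := isPreconnected_re_gt (max (c - M) (c - N))
    have hz₀ : ((c + 1 : ℝ) : ℂ) ∈ {z : ℂ | max (c - M) (c - N) < z.re} := by
      have h1 : (0 : ℝ) ≤ M := M.cast_nonneg
      have h2 : (0 : ℝ) ≤ N := N.cast_nonneg
      simp only [Set.mem_ofPred_eq, ofReal_re, max_lt_iff]
      constructor <;> linarith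
    have hnear : G M =ᶠ[𝓝 ((c + 1 : ℝ) : ℂ)] G N := by
      have : ∀ᶠ z : ℂ in 𝓝 ((c + 1 : ℝ) : ℂ), c < z.re :=
        (isOpen_lt continuous_const continuous_re).mem_nhds (by simp)
      filter_upwards [this] with z hz
      rw [heq M z hz, heq N z hz]
    have := eventuallyEq_nhdsNE_of_isPreconnected hpre
      (fun z hz => hmer M z ((le_max_left _ _).trans_lt hz))
      (fun z hz => hmer N z ((le_max_right _ _).trans_lt hz)) hz₀ (max_lt hM hN)
      (hnear.filter_mono nhdsWithin_le_nhds)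
    exact (AnalyticAt.eventuallyEq_nhds_of_nhdsNE (han M s hM hs) (han N s hN hs) this).eq_of_nhds
  have hidx : ∀ s : ℂ, c - (⌈c - s.re⌉₊ + 1 : ℕ) < s.re := fun s => by
    have := Nat.le_ceil (c - s.re)
    push_cast
    linarith
  have hloc : ∀ s : ℂ, ∃ N : ℕ, c - N < s.re ∧
      ∀ᶠ w in 𝓝 s, w ∉ P → G (⌈c - w.re⌉₊ + 1) w = G N w := fun s => by
    refine ⟨⌈c - s.re⌉₊ + 1, hidx s, ?_⟩
    have : ∀ᶠ w : ℂ in 𝓝 s, c - (⌈c - s.re⌉₊ + 1 : ℕ) < w.re :=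
      (isOpen_lt continuous_const continuous_re).mem_nhds (hidx s)
    filter_upwards [this] with w hw hwP
    exact key _ _ w (hidx w) hw hwP
  -- The index chosen at s jumps as s moves, but by `key` this is invisible off P, so locally the
  -- glued function agrees off P with one fixed `G N`.
  refine ⟨fun s => G (⌈c - s.re⌉₊ + 1) s, fun s => ?_, fun s hs => ?_, fun s hs => heq _ s hs⟩
  · obtain ⟨N, hN, hev⟩ := hloc s
    refine (hmer N s hN).congr ?_
    filter_upwards [hP s, hev.filter_mono nhdsWithin_le_nhds] with w hw hw'
    exact (hw' hw).symm
  · obtain ⟨N, hN, hev⟩ := hloc s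
    refine (han N s hN hs).congr ?_
    have : ∀ᶠ w in 𝓝 s, w ∉ P := by
      have := hP s
      rw [eventually_nhdsWithin_iff] at this
      filter_upwards [this] with w hw
      by_cases hws : w = s
      · rwa [hws]
      · exact hw hws
    filter_upwards [this, hev] with w hw hw'
    exact (hw' hw).symm

theorem eventually_ne_one_sub_natCast (z : ℂ) :
    ∀ᶠ w in 𝓝[≠] z, w ∉ {s : ℂ | ∃ m : ℕ, s = 1 - m} := by
  have hcl : IsClosed ((fun n : ℤ => (n : ℂ)) '' {n : ℤ | n ≠ z}) :=
    Complex.isClosedEmbedding_intCast.isClosedMap _ (isClosed_discrete _)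
  have hz : z ∉ (fun n : ℤ => (n : ℂ)) '' {n : ℤ | n ≠ z} := by
    rintro ⟨n, hn, rfl⟩
    exact hn rfl
  rw [eventually_nhdsWithin_iff]
  filter_upwards [hcl.isOpen_compl.mem_nhds hz] with w hw hwz
  rintro ⟨m, rfl⟩
  refine hw ⟨1 - m, ?_, by push_cast; rfl⟩
  intro h
  apply hwz
  rw [← h]
  simp

/-! ### Principal parts and residues -/

/-- Each step splits off h(c) and divides the rest by z - c through `dslope`, which stays analytic
at c. The identity thus holds for every z, not only near c. -/
theorem _root_.AnalyticAt.exists_taylor_remainder {g : ℂ → ℂ} {c : ℂ} (hg : AnalyticAt ℂ g c)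
    (k : ℕ) : ∃ (b : ℕ → ℂ) (h : ℂ → ℂ), AnalyticAt ℂ h c ∧
      ∀ z, g z = ∑ i ∈ Finset.range k, b i * (z - c) ^ i + (z - c) ^ k * h z := by
  induction k with
  | zero => exact ⟨0, g, hg, by simp⟩
  | succ k ih =>
    obtain ⟨b, h, hh, hz⟩ := ih
    refine ⟨fun i => if i = k then h c else b i, dslope h c, ?_, fun z => ?_⟩
    · obtain ⟨p, hp⟩ := hh
      exact ⟨_, hp.has_fpower_series_dslope_fslope⟩
    · have h1 : h z = h c + (z - c) * dslope h c z := by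
        have := sub_smul_dslope h c z
        rw [smul_eq_mul] at this
        rw [this]; ring
      have h2 : ∑ i ∈ Finset.range k, (if i = k then h c else b i) * (z - c) ^ i =
          ∑ i ∈ Finset.range k, b i * (z - c) ^ i :=
        Finset.sum_congr rfl fun i hi => by rw [if_neg (Finset.mem_range.1 hi).ne]
      simp only [Finset.sum_range_succ, h2, if_true, hz z, h1]
      ring

/-- The principal part at `c` of a function `g z / (z - c) ^ k` with `g` analytic. -/
theorem _root_.AnalyticAt.exists_principalPart {g : ℂ → ℂ} {c : ℂ} (hg : AnalyticAt ℂ g c)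
    (k : ℕ) : ∃ (a : ℕ → ℂ) (h : ℂ → ℂ), AnalyticAt ℂ h c ∧ ∀ z, z ≠ c →
      g z / (z - c) ^ k = ∑ i ∈ Finset.range k, a i / (z - c) ^ (i + 1) + h z := by
  obtain ⟨b, h, hh, hz⟩ := hg.exists_taylor_remainder k
  -- The Taylor term of degree j contributes (z - c)^{-(k-j)}, and k - j = i + 1 means j = k - 1 -
  -- i.
  refine ⟨fun i => b (k - 1 - i), h, hh, fun z hzc => ?_⟩
  have h0 : z - c ≠ 0 := sub_ne_zero.2 hzc
  rw [hz z, add_div, mul_div_cancel_left₀ _ (pow_ne_zero k h0), Finset.sum_div,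
    ← Finset.sum_range_reflect]
  congr 1
  refine Finset.sum_congr rfl fun i hi => ?_
  have hi := Finset.mem_range.1 hi
  rw [div_eq_div_iff (pow_ne_zero _ h0) (pow_ne_zero _ h0), mul_assoc, ← pow_add]
  congr 2
  omega

theorem residue_eq_of_circleIntegral {f : ℂ → ℂ} {c a : ℂ}
    (h : ∀ᶠ r : ℝ in 𝓝[>] 0, (∮ z in C(c, r), f z) = 2 * Real.pi * I * a) : residue f c = a := by
  refine Tendsto.limUnder_eq (tendsto_const_nhds.congr' ?_)
  filter_upwards [h] with r hr
  rw [hr, ← mul_assoc, inv_mul_cancel₀ two_pi_I_ne_zero, one_mul]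

/-- The residue of `F g` when `F` has a given principal part and `g` is entire. -/
theorem residue_mul_eq {F h g : ℂ → ℂ} {c : ℂ} {k : ℕ} {a : ℕ → ℂ} (hh : AnalyticAt ℂ h c)
    (hg : Differentiable ℂ g)
    (hF : ∀ᶠ z in 𝓝[≠] c, F z = ∑ i ∈ Finset.range k, a i / (z - c) ^ (i + 1) + h z) :
    residue (fun z => F z * g z) c =
      ∑ i ∈ Finset.range k, a i * (iteratedDeriv i g c / i.factorial) := by
  apply residue_eq_of_circleIntegral
  obtain ⟨ε, hε, hball⟩ := Metric.eventually_nhds_iff_ball.1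
    ((eventually_nhdsWithin_iff.1 hF).and hh.eventually_analyticAt)
  filter_upwards [Ioo_mem_nhdsGT hε] with r hr
  have hr0 : 0 < r := hr.1
  have hsub : Metric.closedBall c r ⊆ Metric.ball c ε := Metric.closedBall_subset_ball hr.2
  have hne : ∀ z ∈ Metric.sphere c r, z ≠ c := fun z hz => Metric.ne_of_mem_sphere hz hr0.ne'
  have hc1 : ∀ i, ContinuousOn (fun z => a i * ((1 / (z - c) ^ (i + 1)) • g z))
      (Metric.sphere c r) := fun i => by
    refine continuousOn_const.mul (ContinuousOn.fun_smul ?_ hg.continuous.continuousOn)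
    refine ContinuousOn.div continuousOn_const (by fun_prop) fun z hz => ?_
    exact pow_ne_zero _ (sub_ne_zero.2 (hne z hz))
  have hd : DifferentiableOn ℂ (fun z => h z * g z) (Metric.closedBall c r) := fun z hz =>
    (((hball z (hsub hz)).2.differentiableAt).mul (hg z)).differentiableWithinAt
  have hcongr : (∮ z in C(c, r), F z * g z) = ∮ z in C(c, r),
      ((∑ i ∈ Finset.range k, a i * ((1 / (z - c) ^ (i + 1)) • g z)) + h z * g z) := by
    refine circleIntegral.integral_congr hr0.le fun z hz => ?_
    rw [(hball z (hsub (Metric.sphere_subset_closedBall hz))).1 (hne z hz), add_mul,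
      Finset.sum_mul]
    congr 1
    refine Finset.sum_congr rfl fun i _ => ?_
    rw [smul_eq_mul]; ring
  rw [hcongr, circleIntegral.integral_add]
  · rw [circleIntegral.integral_fun_sum]
    · have hzero : (∮ z in C(c, r), h z * g z) = 0 :=
        Complex.circleIntegral_eq_zero_of_differentiable_on_off_countable hr0.le
          Set.countable_empty hd.continuousOn fun z hz =>
            (hd z (Metric.ball_subset_closedBall hz.1)).differentiableAt
              (Metric.closedBall_mem_nhds_of_mem hz.1)
      rw [hzero, add_zero, Finset.mul_sum]
      refine Finset.sum_congr rfl fun i _ => ?_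
      rw [circleIntegral.integral_const_mul,
        hg.differentiableOn.circleIntegral_one_div_sub_center_pow_smul hr0 i, smul_eq_mul]
      ring
    · exact fun i _ => (hc1 i).circleIntegrable hr0.le
  · exact (continuousOn_finsetSum _ fun i _ => hc1 i).circleIntegrable hr0.le
  · exact (hd.continuousOn.mono Metric.sphere_subset_closedBall).circleIntegrable hr0.le

/-! ### The regular part of ζ and Dirichlet series of powers of log -/

/-- The entire function `ζ(s) - 1 / (s - 1)`. -/
noncomputable def zetaRegular : ℂ → ℂ :=
  Function.update (fun s => riemannZeta s - 1 / (s - 1)) 1 Real.eulerMascheroniConstant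

theorem zetaRegular_of_ne {s : ℂ} (hs : s ≠ 1) : zetaRegular s = riemannZeta s - 1 / (s - 1) :=
  Function.update_of_ne hs _ _

theorem riemannZeta_eq_add_zetaRegular {s : ℂ} (hs : s ≠ 1) :
    riemannZeta s = (s - 1)⁻¹ + zetaRegular s := by
  rw [zetaRegular_of_ne hs]; ring

/-- The singularity at 1 is removable: the value assigned there, Euler's constant, is the limit of
ζ(s) - 1/(s-1). -/
theorem differentiable_zetaRegular : Differentiable ℂ zetaRegular := by
  have h : ∀ z : ℂ, z ≠ 1 → DifferentiableAt ℂ zetaRegular z := fun z hz => by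
    have h1 : DifferentiableAt ℂ (fun s => riemannZeta s - 1 / (s - 1)) z :=
      (differentiableAt_riemannZeta hz).sub
        ((differentiableAt_const _).div (differentiableAt_id.sub_const 1) (sub_ne_zero.2 hz))
    refine h1.congr_of_eventuallyEq ?_
    filter_upwards [isOpen_ne.mem_nhds hz] with w hw using zetaRegular_of_ne hw
  intro z
  rcases eq_or_ne z 1 with rfl | hz
  · refine (analyticAt_of_differentiable_on_punctured_nhds_of_continuousAt ?_ ?_).differentiableAt
    · filter_upwards [self_mem_nhdsWithin] with w hw using h w hw
    · exact continuousAt_update_same.2 tendsto_riemannZeta_sub_one_div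
  · exact h z hz

theorem analyticAt_riemannZeta {s : ℂ} (hs : s ≠ 1) : AnalyticAt ℂ riemannZeta s := by
  refine DifferentiableOn.analyticAt (s := {1}ᶜ) (fun z hz => ?_) (isOpen_ne.mem_nhds hs)
  exact (differentiableAt_riemannZeta hz).differentiableWithinAt

theorem meromorphic_riemannZeta : Meromorphic riemannZeta := by
  intro s
  rcases eq_or_ne s 1 with rfl | hs
  · have h : MeromorphicAt (fun s : ℂ => (s - 1)⁻¹ + zetaRegular s) 1 :=
      ((MeromorphicAt.id 1).sub (MeromorphicAt.const 1 1)).inv.add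
        (differentiable_zetaRegular.analyticAt 1).meromorphicAt
    refine h.congr ?_
    filter_upwards [self_mem_nhdsWithin] with w hw using (riemannZeta_eq_add_zetaRegular hw).symm
  · exact (analyticAt_riemannZeta hs).meromorphicAt

theorem iteratedDeriv_inv_sub_one (i : ℕ) (w : ℂ) :
    iteratedDeriv i (fun z : ℂ => (z - 1)⁻¹) w =
      (-1) ^ i * i.factorial / (w - 1) ^ (i + 1) := by
  have := congrFun (iteratedDeriv_comp_sub_const i (fun z : ℂ => z⁻¹) 1) w
  rw [this, iteratedDeriv_eq_iterate, iter_deriv_inv]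
  have : (-1 - i : ℤ) = -((i + 1 : ℕ) : ℤ) := by push_cast; ring
  rw [this, zpow_neg, zpow_natCast, div_eq_mul_inv]

/-- The function `∑ (log n)^i / i! n^{-w}`, whose only pole is at `w = 1`. -/
noncomputable def logPowSeries (i : ℕ) (w : ℂ) : ℂ :=
  1 / (w - 1) ^ (i + 1) + (-1) ^ i / i.factorial * iteratedDeriv i zetaRegular w

theorem differentiable_iteratedDeriv_zetaRegular (i : ℕ) :
    Differentiable ℂ (iteratedDeriv i zetaRegular) :=
  (differentiable_zetaRegular.contDiff (n := ⊤)).differentiable_iteratedDeriv i (by simp)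

theorem iterate_logMul_one (i : ℕ) (n : ℕ) :
    (LSeries.logMul^[i] (1 : ℕ → ℂ)) n = (log n) ^ i := by
  induction i with
  | zero => simp
  | succ i ih =>
    rw [Function.iterate_succ_apply', LSeries.logMul, ih, pow_succ, mul_comm]

theorem LSeriesSummable_log_pow (i : ℕ) {w : ℂ} (hw : 1 < w.re) :
    LSeriesSummable (fun n => log n ^ i) w := by
  have h : LSeries.abscissaOfAbsConv (LSeries.logMul^[i] (1 : ℕ → ℂ)) < w.re := by
    rw [LSeries.absicssaOfAbsConv_logPowMul, LSeries.abscissaOfAbsConv_one]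
    exact_mod_cast hw
  have := LSeriesSummable_of_abscissaOfAbsConv_lt_re h
  rwa [funext (iterate_logMul_one i)] at this

/-- Differentiate ζ(w) = 1/(w-1) + `zetaRegular` w termwise i times; the sign (-1)^i comes from d/dw
n^{-w} = -log n · n^{-w}. -/
theorem LSeries_log_pow (i : ℕ) {w : ℂ} (hw : 1 < w.re) :
    LSeries (fun n => log n ^ i) w = i.factorial * logPowSeries i w := by
  have hw' : LSeries.abscissaOfAbsConv (1 : ℕ → ℂ) < w.re := by
    rw [LSeries.abscissaOfAbsConv_one]; exact_mod_cast hw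
  have hw1 : w ≠ 1 := fun h => by simp [h] at hw
  have h1 := LSeries_iteratedDeriv i hw'
  rw [funext (iterate_logMul_one i)] at h1
  have h2 : LSeries 1 =ᶠ[𝓝 w] fun z => (z - 1)⁻¹ + zetaRegular z := by
    filter_upwards [(isOpen_lt continuous_const continuous_re).mem_nhds hw] with z hz
    have hz1 : z ≠ 1 := fun h => by simp [h] at hz
    rw [LSeries_one_eq_riemannZeta hz, riemannZeta_eq_add_zetaRegular hz1]
  have h3 : ContDiffAt ℂ i (fun z : ℂ => (z - 1)⁻¹) w :=
    (contDiffAt_id.sub contDiffAt_const).inv (sub_ne_zero.2 hw1)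
  rw [h2.iteratedDeriv_eq, iteratedDeriv_fun_add h3
    (differentiable_zetaRegular.contDiff).contDiffAt, iteratedDeriv_inv_sub_one] at h1
  have h4 : ((-1 : ℂ) ^ i) * (-1) ^ i = 1 := by rw [← mul_pow]; simp
  have h5 : (i.factorial : ℂ) ≠ 0 := by exact_mod_cast i.factorial_ne_zero
  have h6 := congrArg (fun t => (-1 : ℂ) ^ i * t) h1
  simp only [← mul_assoc, h4, one_mul] at h6
  rw [← h6, logPowSeries]
  have h7 : (w - 1) ^ (i + 1) ≠ 0 := pow_ne_zero _ (sub_ne_zero.2 hw1)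
  field_simp
  linear_combination (i.factorial : ℂ) * h4

theorem analyticAt_logPowSeries (i : ℕ) {w : ℂ} (hw : w ≠ 1) :
    AnalyticAt ℂ (logPowSeries i) w := by
  refine AnalyticAt.add ?_ ?_
  · exact analyticAt_const.div ((analyticAt_id.sub analyticAt_const).pow _)
      (pow_ne_zero _ (sub_ne_zero.2 hw))
  · exact analyticAt_const.mul ((differentiable_iteratedDeriv_zetaRegular i).analyticAt w)

/-! ### The main term -/

/-- The function `ζ(w) ^ k / w`. -/
noncomputable def zetaPowDiv (k : ℕ) (w : ℂ) : ℂ := riemannZeta w ^ k / w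

theorem analyticAt_zetaPowDiv (k : ℕ) {w : ℂ} (h0 : w ≠ 0) (h1 : w ≠ 1) :
    AnalyticAt ℂ (zetaPowDiv k) w :=
  ((analyticAt_riemannZeta h1).pow k).div analyticAt_id h0

theorem meromorphic_zetaPowDiv (k : ℕ) : Meromorphic (zetaPowDiv k) := fun w =>
  ((meromorphic_riemannZeta w).pow k).div (MeromorphicAt.id w)

theorem exists_principalPart_zetaPowDiv (k : ℕ) : ∃ (a : ℕ → ℂ) (h : ℂ → ℂ), AnalyticAt ℂ h 1 ∧
    ∀ z, z ≠ 1 → zetaPowDiv k z = ∑ i ∈ Finset.range k, a i / (z - 1) ^ (i + 1) + h z := by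
  -- Numerator obtained by writing ζ(z) = (1 + (z-1) `zetaRegular` z)/(z-1).
  have hg : AnalyticAt ℂ (fun z => (1 + (z - 1) * zetaRegular z) ^ k / z) 1 :=
    (((analyticAt_const.add ((analyticAt_id.sub analyticAt_const).mul
      (differentiable_zetaRegular.analyticAt 1))).pow k).div analyticAt_id one_ne_zero)
  obtain ⟨a, h, hh, hz⟩ := hg.exists_principalPart k
  refine ⟨a, h, hh, fun z hz1 => ?_⟩
  have h0 : z - 1 ≠ 0 := sub_ne_zero.2 hz1
  rw [← hz z hz1, zetaPowDiv, riemannZeta_eq_add_zetaRegular hz1, div_right_comm, ← div_pow]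
  congr 2
  field_simp

/-- The main term is `n` times a polynomial in `log n`, and the difference between `ζ(w)^k / w` and
the Dirichlet series of the main term is regular at `w = 1`. -/
theorem exists_mainTerm_eq (k : ℕ) : ∃ (a : ℕ → ℂ) (Q : ℂ → ℂ),
    (∀ n : ℕ, n ≠ 0 →
      mainTerm k n = ∑ i ∈ Finset.range k, a i / i.factorial * (n * log n ^ i)) ∧
    Meromorphic Q ∧ (∀ w, w ≠ 0 → AnalyticAt ℂ Q w) ∧
    ∀ w, w ≠ 1 → Q w = zetaPowDiv k w - ∑ i ∈ Finset.range k, a i * logPowSeries i w := by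
  obtain ⟨a, h, hh, hz⟩ := exists_principalPart_zetaPowDiv k
  set R : ℂ → ℂ := fun w => zetaPowDiv k w - ∑ i ∈ Finset.range k, a i * logPowSeries i w with hR
  -- What is left of R after the polar terms a_i/(w-1)^{i+1} cancel; it equals R off 1 and supplies
  -- the value there.
  set q : ℂ → ℂ := fun w => h w - ∑ i ∈ Finset.range k,
    a i * ((-1) ^ i / i.factorial * iteratedDeriv i zetaRegular w) with hq
  have hqan : AnalyticAt ℂ q 1 := hh.sub (Finset.analyticAt_fun_sum _ fun i _ =>
    analyticAt_const.mul (analyticAt_const.mul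
      ((differentiable_iteratedDeriv_zetaRegular i).analyticAt 1)))
  have hne : ∀ w, w ≠ 1 → Function.update R 1 (q 1) w = R w := fun w hw =>
    Function.update_of_ne hw _ _
  have han : ∀ w, w ≠ 0 → AnalyticAt ℂ (Function.update R 1 (q 1)) w := by
    intro w hw0
    rcases eq_or_ne w 1 with rfl | hw1
    · refine hqan.congr (Eventually.of_forall fun w => ?_)
      rcases eq_or_ne w 1 with rfl | hw1
      · simp
      · rw [hne w hw1]
        simp only [hR, hq, logPowSeries, hz w hw1, mul_add, Finset.sum_add_distrib]
        simp only [mul_one_div]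
        ring
    · have : AnalyticAt ℂ R w := (analyticAt_zetaPowDiv k hw0 hw1).sub
        (Finset.analyticAt_fun_sum _ fun i _ => analyticAt_const.mul
          (analyticAt_logPowSeries i hw1))
      refine this.congr ?_
      filter_upwards [isOpen_ne.mem_nhds hw1] with z hz using (hne z hz).symm
  refine ⟨a, Function.update R 1 (q 1), fun n hn => ?_, fun w => ?_, han, hne⟩
  · have hn0 : (n : ℂ) ≠ 0 := by exact_mod_cast hn
    -- With n^s = exp(s log n), the i-th derivative at s = 1 is n (log n)^i.
    have h1 : (fun s : ℂ => riemannZeta s ^ k * (((n : ℝ) : ℂ)) ^ s / s) =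
        fun s => zetaPowDiv k s * cexp (log n * s) := by
      funext s
      rw [ofReal_natCast, cpow_def_of_ne_zero hn0, zetaPowDiv]
      ring
    have hF : ∀ᶠ z in 𝓝[≠] (1 : ℂ), zetaPowDiv k z =
        ∑ i ∈ Finset.range k, a i / (z - 1) ^ (i + 1) + h z := by
      filter_upwards [self_mem_nhdsWithin] with z hz1 using hz z hz1
    rw [mainTerm, h1, residue_mul_eq hh (by fun_prop) hF]
    refine Finset.sum_congr rfl fun i _ => ?_
    rw [iteratedDeriv_cexp_const_mul]
    simp only [mul_one, exp_log hn0]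
    ring
  · rcases eq_or_ne w 0 with rfl | hw0
    · have : MeromorphicAt R 0 := (meromorphic_zetaPowDiv k 0).sub
        (MeromorphicAt.fun_sum fun i _ => (MeromorphicAt.const _ _).mul
          (analyticAt_logPowSeries i zero_ne_one).meromorphicAt)
      refine this.congr ?_
      filter_upwards [mem_nhdsWithin_of_mem_nhds (isOpen_ne.mem_nhds (zero_ne_one (α := ℂ)))]
        with z hz using (hne z hz).symm
    · exact (han w hw0).meromorphicAt

/-! ### The Piltz function and its summatory function -/

/-- Splitting off the first factor of a tuple. This exhibits d_{k+1} as the Dirichlet convolution of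
1 and d_k, whence the generating series ζ^k. -/
theorem d_succ (k n : ℕ) : d (k + 1) n = ∑ p ∈ n.divisorsAntidiagonal, d k p.2 := by
  simp only [d]
  rw [← Finset.card_sigma]
  refine Finset.card_nbij' (fun f => ⟨(f 0, ∏ i, Fin.tail f i), Fin.tail f⟩)
    (fun x => Fin.cons x.1.1 x.2) ?_ ?_ ?_ ?_
  · intro f hf
    obtain ⟨h1, h2⟩ := Nat.mem_finMulAntidiag.1 hf
    rw [Fin.prod_univ_succ] at h1
    have h3 : ∏ i, Fin.tail f i ≠ 0 := fun h => h2 (by rw [← h1]; exact mul_eq_zero_of_right _ h)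
    simp only [Finset.coe_sigma, Set.mem_sigma_iff, Finset.mem_coe, Nat.mem_divisorsAntidiagonal,
      Nat.mem_finMulAntidiag]
    exact ⟨⟨h1, h2⟩, trivial, h3⟩
  · rintro ⟨⟨p, q⟩, g⟩ hx
    simp only [Finset.coe_sigma, Set.mem_sigma_iff, Finset.mem_coe, Nat.mem_divisorsAntidiagonal,
      Nat.mem_finMulAntidiag] at hx
    obtain ⟨⟨h1, h2⟩, h3, h4⟩ := hx
    simp only [Finset.mem_coe, Nat.mem_finMulAntidiag, Fin.prod_univ_succ, Fin.cons_zero,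
      Fin.cons_succ]
    exact ⟨by rw [h3, h1], h2⟩
  · intro f _
    exact Fin.cons_self_tail f
  · rintro ⟨⟨p, q⟩, g⟩ hx
    simp only [Finset.coe_sigma, Set.mem_sigma_iff, Finset.mem_coe, Nat.mem_divisorsAntidiagonal,
      Nat.mem_finMulAntidiag] at hx
    obtain ⟨⟨h1, h2⟩, h3, h4⟩ := hx
    simp [h3]

theorem LSeriesHasSum_d (k : ℕ) {s : ℂ} (hs : 1 < s.re) :
    LSeriesHasSum (fun n => (d k n : ℂ)) s (riemannZeta s ^ k) := by
  induction k with
  | zero =>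
    have h : LSeries.term (fun n => (d 0 n : ℂ)) s = fun n => if n = 1 then 1 else 0 := by
      funext n
      rw [← LSeries.term_delta s n]
      refine LSeries.term_congr (fun {n} hn => ?_) s n
      rcases eq_or_ne n 1 with rfl | h1
      · simp [d, LSeries.delta, Nat.finMulAntidiag_one]
      · simp [d, LSeries.delta, Nat.finMulAntidiag_zero_left h1, h1]
    rw [LSeriesHasSum, h, pow_zero]
    exact hasSum_ite_eq 1 1
  | succ k ih =>
    have h1 : LSeriesHasSum 1 s (riemannZeta s) := by
      rw [← LSeries_one_eq_riemannZeta hs]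
      exact (LSeriesSummable_one_iff.2 hs).LSeriesHasSum
    have h2 := h1.convolution ih
    rw [← pow_succ'] at h2
    refine (LSeriesHasSum_congr s _ fun {n} _ => ?_).1 h2
    rw [LSeries.convolution_def, d_succ]
    simp

/-- The summatory function of `d_k`. -/
noncomputable def dSum (k n : ℕ) : ℂ := ∑ m ∈ Finset.Icc 1 n, (d k m : ℂ)

theorem dSum_sub_dSum_pred (k : ℕ) {n : ℕ} (hn : n ≠ 0) :
    dSum k n - dSum k (n - 1) = d k n := by
  obtain ⟨m, rfl⟩ := Nat.exists_eq_succ_of_ne_zero hn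
  rw [dSum, dSum, Nat.succ_sub_one, Finset.sum_Icc_succ_top (by omega)]
  ring

/-- Rankin's trick: for m ≤ n one has 1 ≤ (n/m)^σ, so the sum is at most n^σ times the convergent
series ∑ d_k(m) m^{-σ}. -/
theorem exists_norm_dSum_le (k : ℕ) {σ : ℝ} (hσ : 1 < σ) :
    ∃ C : ℝ, ∀ n : ℕ, ‖dSum k n‖ ≤ C * (n : ℝ) ^ σ := by
  have hsum : Summable fun n => ‖LSeries.term (fun n => (d k n : ℂ)) (σ : ℂ) n‖ :=
    (LSeriesHasSum_d k (s := (σ : ℂ)) (by simpa using hσ)).summable.norm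
  refine ⟨∑' n, ‖LSeries.term (fun n => (d k n : ℂ)) (σ : ℂ) n‖, fun n => ?_⟩
  rw [dSum]
  calc ‖∑ m ∈ Finset.Icc 1 n, (d k m : ℂ)‖ ≤ ∑ m ∈ Finset.Icc 1 n, ‖(d k m : ℂ)‖ :=
        norm_sum_le _ _
    _ ≤ ∑ m ∈ Finset.Icc 1 n, ‖LSeries.term (fun n => (d k n : ℂ)) (σ : ℂ) m‖ * (n : ℝ) ^ σ := by
        refine Finset.sum_le_sum fun m hm => ?_
        obtain ⟨hm1, hmn⟩ := Finset.mem_Icc.1 hm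
        have hm0 : 0 < (m : ℝ) := by exact_mod_cast hm1
        have hpos : 0 < (m : ℝ) ^ σ := Real.rpow_pos_of_pos hm0 σ
        rw [LSeries.norm_term_eq, if_neg (by omega), ofReal_re, div_mul_eq_mul_div,
          le_div_iff₀ hpos]
        exact mul_le_mul_of_nonneg_left
          (Real.rpow_le_rpow hm0.le (by exact_mod_cast hmn) (by linarith)) (norm_nonneg _)
    _ ≤ _ := by
        rw [← Finset.sum_mul]
        exact mul_le_mul_of_nonneg_right
          (hsum.sum_le_tsum _ fun _ _ => norm_nonneg _) (by positivity)

theorem LSeriesSummable_dSum (k : ℕ) {s : ℂ} (hs : 2 < s.re) : LSeriesSummable (dSum k) s := by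
  -- The choice σ = Re s / 2 satisfies both σ > 1 and σ + 1 < Re s.
  obtain ⟨C, hC⟩ := exists_norm_dSum_le k (σ := s.re / 2) (by linarith)
  refine LSeriesSummable_of_le_const_mul_rpow (x := s.re / 2 + 1) (by linarith) ⟨C, fun n _ => ?_⟩
  simpa using hC n

theorem mul_LSeries_dSum (k J : ℕ) {s : ℂ} (hs : 3 < s.re) :
    s * LSeries (dSum k) (s + 1) = riemannZeta s ^ k +
      ∑ i ∈ Finset.range J, negBinomCoeff (i + 2) s * LSeries (dSum k) (s + i + 2) +
        remSeries (dSum k) (J + 2) s := by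
  obtain ⟨C, hC⟩ := exists_norm_dSum_le k one_lt_two
  have hC' : ∀ n : ℕ, ‖dSum k n‖ ≤ C * (n : ℝ) ^ 2 := fun n => by
    have := hC n
    rwa [← Nat.cast_two, Real.rpow_natCast] at this
  rw [mul_LSeries_partialSum hC' J hs]
  congr 2
  rw [LSeries_congr (g := fun n => (d k n : ℂ)) (fun {n} hn => dSum_sub_dSum_pred k hn) s]
  exact (LSeriesHasSum_d k (by linarith)).LSeries_eq

/-! ### Continuation of the Dirichlet series of the summatory function -/

/-- The possible poles `1, 0, -1, -2, …`. -/
def poles : Set ℂ := {s | ∃ m : ℕ, s = 1 - m}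

theorem exists_continuation_halfPlane (k N : ℕ) : ∃ G : ℂ → ℂ,
    (∀ s, 4 - (N : ℝ) < s.re → MeromorphicAt G s) ∧
    (∀ s, 4 - (N : ℝ) < s.re → s ∉ poles → AnalyticAt ℂ G s) ∧
    ∀ s, (4 : ℝ) < s.re → G s = LSeries (dSum k) s - zetaPowDiv k (s - 1) := by
  obtain ⟨C, hC⟩ := exists_norm_dSum_le k one_lt_two
  have hC' : ∀ n : ℕ, ‖dSum k n‖ ≤ C * (n : ℝ) ^ 2 := fun n => by
    have := hC n
    rwa [← Nat.cast_two, Real.rpow_natCast] at this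
  induction N with
  | zero =>
    have h : ∀ s : ℂ, 4 - ((0 : ℕ) : ℝ) < s.re →
        AnalyticAt ℂ (fun s => LSeries (dSum k) s - zetaPowDiv k (s - 1)) s := by
      intro s hs
      have hs : 4 < s.re := by simpa using hs
      refine AnalyticAt.sub ?_ ?_
      · refine LSeries_analyticOnNhd (dSum k) s ?_
        have : LSeriesSummable (dSum k) 3 := LSeriesSummable_dSum k (by norm_num)
        refine this.abscissaOfAbsConv_le.trans_lt ?_
        have : ((3 : ℂ).re) < s.re := by norm_num; linarith
        exact_mod_cast this
      · refine (analyticAt_zetaPowDiv k ?_ ?_).comp (analyticAt_id.sub analyticAt_const)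
        · intro h0; have := congrArg re h0; simp at this; linarith
        · intro h0; have := congrArg re h0; simp at this; linarith
    exact ⟨_, fun s hs => (h s hs).meromorphicAt, fun s hs _ => h s hs, fun _ _ => rfl⟩
  | succ N ih =>
    obtain ⟨G, hmer, han, heq⟩ := ih
    have hre : ∀ s : ℂ, 4 - ((N + 1 : ℕ) : ℝ) < s.re → ∀ i : ℕ,
        4 - (N : ℝ) < (s + i + 1).re := fun s hs i => by
      have : (0 : ℝ) ≤ i := i.cast_nonneg
      push_cast at hs
      simp only [add_re, natCast_re, one_re]
      linarith
    have hrem : ∀ s : ℂ, 4 - ((N + 1 : ℕ) : ℝ) < s.re →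
        AnalyticAt ℂ (fun s => remSeries (dSum k) (N + 2) (s - 1)) s := fun s hs => by
      refine (analyticAt_remSeries hC' (N + 2) ?_).comp (analyticAt_id.sub analyticAt_const)
      push_cast at hs ⊢
      simp only [sub_re, one_re]
      linarith
    have hcoef : ∀ (j : ℕ) (s : ℂ), AnalyticAt ℂ (fun s => negBinomCoeff j (s - 1)) s := fun j s =>
      ((differentiable_negBinomCoeff j).comp (differentiable_id.sub_const 1)).analyticAt s
    -- This is `mul_LSeries_dSum` at s - 1 with J = N, solved for L(A, s); the term ζ(s-1)^k/(s-1)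
    -- is the one being subtracted. Each L(A, s+i+1) is replaced by G(s+i+1) + ζ(s+i)^k/(s+i). The
    -- remainder of order N + 2 is holomorphic for Re(s-1) > 4 - (N+2), that is, Re s > 4 - (N+1).
    refine ⟨fun s => (∑ i ∈ Finset.range N, negBinomCoeff (i + 2) (s - 1) *
      (G (s + i + 1) + zetaPowDiv k (s + i)) + remSeries (dSum k) (N + 2) (s - 1)) / (s - 1),
      fun s hs => ?_, fun s hs hsP => ?_, fun s hs => ?_⟩
    · refine MeromorphicAt.div (MeromorphicAt.add (MeromorphicAt.fun_sum fun i _ =>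
        (hcoef _ s).meromorphicAt.mul (MeromorphicAt.add ?_ ?_)) (hrem s hs).meromorphicAt)
        ((MeromorphicAt.id s).sub (MeromorphicAt.const 1 s))
      · simp only [add_assoc]
        refine meromorphicAt_comp_add_const_iff_meromorphicAt.2 ?_
        rw [← add_assoc]
        exact hmer _ (hre s hs i)
      · exact meromorphicAt_comp_add_const_iff_meromorphicAt.2 (meromorphic_zetaPowDiv k _)
    · refine AnalyticAt.div (AnalyticAt.add (Finset.analyticAt_fun_sum _ fun i _ =>
        (hcoef _ s).mul (AnalyticAt.add ?_ ?_)) (hrem s hs))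
        (analyticAt_id.sub analyticAt_const) ?_
      · refine AnalyticAt.fun_comp (g := G) (han _ (hre s hs i) ?_)
          ((analyticAt_id.add analyticAt_const).add analyticAt_const)
        rintro ⟨m, hm⟩
        refine hsP ⟨m + i + 1, ?_⟩
        push_cast
        linear_combination hm
      · refine AnalyticAt.fun_comp (g := zetaPowDiv k) (analyticAt_zetaPowDiv k ?_ ?_)
          (analyticAt_id.add analyticAt_const)
        -- The factor ζ(s+i)^k/(s+i) can be singular only at s = -i and s = 1 - i, both in `poles`.
        · intro h0
          refine hsP ⟨i + 1, ?_⟩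
          push_cast
          linear_combination h0
        · intro h0
          exact hsP ⟨i, by linear_combination h0⟩
      · intro h0
        exact hsP ⟨0, by simpa [sub_eq_zero] using h0⟩
    · have h0 : s - 1 ≠ 0 := by
        intro h0; have := congrArg re h0; simp at this; linarith
      have hJ := mul_LSeries_dSum k N (s := s - 1) (by simp; linarith)
      rw [sub_add_cancel] at hJ
      have hterm : ∀ i : ℕ, G (s + i + 1) + zetaPowDiv k (s + i) =
          LSeries (dSum k) (s - 1 + i + 2) := fun i => by
        have : (0 : ℝ) ≤ i := i.cast_nonneg
        rw [heq (s + i + 1) (by simp only [add_re, natCast_re, one_re]; linarith),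
          add_sub_cancel_right, sub_add_cancel]
        congr 1
        ring
      simp only [hterm]
      rw [div_eq_iff h0, sub_mul, zetaPowDiv, div_mul_cancel₀ _ h0]
      linear_combination -hJ

/-! ### The Dirichlet series of Δ_k -/

theorem Delta_natCast (k n : ℕ) : Delta k (n : ℝ) = dSum k n - mainTerm k n := by
  rw [Delta, Nat.floor_natCast, dSum]

theorem term_natCast_mul (g : ℕ → ℂ) (s : ℂ) :
    LSeries.term (fun n => n * g n) s = LSeries.term g (s - 1) := by
  funext n
  rcases eq_or_ne n 0 with rfl | hn
  · simp
  have hn0 : (n : ℂ) ≠ 0 := by exact_mod_cast hn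
  rw [LSeries.term_of_ne_zero hn, LSeries.term_of_ne_zero hn, cpow_sub _ _ hn0, cpow_one]
  field_simp

theorem LSeriesHasSum_natCast_mul_log_pow (i : ℕ) {s : ℂ} (hs : 2 < s.re) :
    LSeriesHasSum (fun n => n * log n ^ i) s (i.factorial * logPowSeries i (s - 1)) := by
  have hs' : 1 < (s - 1).re := by simp; linarith
  rw [LSeriesHasSum, term_natCast_mul, ← LSeries_log_pow i hs']
  exact (LSeriesSummable_log_pow i hs').LSeriesHasSum

theorem LSeriesHasSum_Delta {k : ℕ} {a : ℕ → ℂ} (ha : ∀ n : ℕ, n ≠ 0 →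
    mainTerm k n = ∑ i ∈ Finset.range k, a i / i.factorial * (n * log n ^ i)) {s : ℂ}
    (hs : 2 < s.re) : LSeriesHasSum (fun n : ℕ => Delta k (n : ℝ)) s
      (LSeries (dSum k) s - ∑ i ∈ Finset.range k, a i * logPowSeries i (s - 1)) := by
  have h1 : LSeriesHasSum (∑ i ∈ Finset.range k,
      (a i / i.factorial) • fun n : ℕ => ((n : ℂ) * log n ^ i)) s
      (∑ i ∈ Finset.range k, a i * logPowSeries i (s - 1)) := by
    refine LSeriesHasSum.sum fun i _ => ?_
    have := (LSeriesHasSum_natCast_mul_log_pow i hs).smul (a i / i.factorial)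
    have h0 : (i.factorial : ℂ) ≠ 0 := by exact_mod_cast i.factorial_ne_zero
    rwa [← mul_assoc, div_mul_cancel₀ _ h0] at this
  have h2 := (LSeriesSummable_dSum k hs).LSeriesHasSum.sub h1
  refine (LSeriesHasSum_congr s _ fun {n} hn => ?_).1 h2
  rw [Delta_natCast, ha n hn]
  simp

theorem abscissaOfAbsConv_Delta_le (k : ℕ) :
    LSeries.abscissaOfAbsConv (fun n : ℕ => Delta k (n : ℝ)) ≤ 2 := by
  obtain ⟨a, Q, ha, -⟩ := exists_mainTerm_eq k
  refine LSeries.abscissaOfAbsConv_le_of_forall_lt_LSeriesSummable (x := 2) fun y hy => ?_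
  exact (LSeriesHasSum_Delta ha (by simpa using hy)).LSeriesSummable

/-- Adding and subtracting ζ(s-1)^k/(s-1) splits the series into T(s), continued by recursion, and
Q(s-1), whose only possible pole is s = 1. -/
theorem exists_meromorphic_continuation (k : ℕ) : ∃ G : ℂ → ℂ, Meromorphic G ∧
    (∀ s, s ∉ poles → AnalyticAt ℂ G s) ∧
    ∀ s : ℂ, 4 < s.re → G s = LSeries (fun n : ℕ => Delta k (n : ℝ)) s := by
  obtain ⟨a, Q, ha, hQmer, hQan, hQ⟩ := exists_mainTerm_eq k
  obtain ⟨T, hTmer, hTan, hT⟩ := exists_meromorphic_of_forall_halfPlane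
    (P := poles) eventually_ne_one_sub_natCast (exists_continuation_halfPlane k)
  have hQan' : ∀ s, s ∉ poles → AnalyticAt ℂ (fun s => Q (s - 1)) s := fun s hs =>
    AnalyticAt.fun_comp (g := Q) (hQan _ fun h => hs ⟨0, by simpa [sub_eq_zero] using h⟩)
      (analyticAt_id.sub analyticAt_const)
  refine ⟨fun s => T s + Q (s - 1), fun s => (hTmer s).add ?_,
    fun s hs => (hTan s hs).add (hQan' s hs), fun s hs => ?_⟩
  · exact meromorphicAt_comp_sub_const_iff_meromorphicAt.2 (hQmer _)
  · have h1 : s - 1 ≠ 1 := by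
      intro h0; have := congrArg re h0; simp at this; linarith
    simp only
    rw [(LSeriesHasSum_Delta ha (by linarith)).LSeries_eq, hT s hs, hQ _ h1]
    ring

/-- The abscissa is an extended real and may be -∞: for k = 1 every Δ_1(n) is 0. -/
theorem isPreconnected_lt_re_EReal (a : EReal) : IsPreconnected {s : ℂ | a < s.re} := by
  have h : Set.OrdConnected {x : ℝ | a < x} :=
    ⟨fun x hx y _ z hz => lt_of_lt_of_le hx (EReal.coe_le_coe_iff.2 hz.1)⟩
  exact (h.convex.linear_preimage reLm).isPreconnected

/-- A meromorphic continuation of an `L`-series can be chosen to agree with it on the whole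
half-plane of absolute convergence. -/
theorem exists_meromorphic_eq_LSeries {f : ℕ → ℂ} {c : ℝ} {P : Set ℂ}
    (hP : ∀ z, ∀ᶠ w in 𝓝[≠] z, w ∉ P) (hf : LSeries.abscissaOfAbsConv f ≤ c) {G : ℂ → ℂ}
    (hmer : Meromorphic G) (han : ∀ s, s ∉ P → AnalyticAt ℂ G s)
    (hG : ∀ s : ℂ, c < s.re → G s = LSeries f s) :
    ∃ F : ℂ → ℂ, Meromorphic F ∧
      (∀ s : ℂ, LSeries.abscissaOfAbsConv f < s.re → F s = LSeries f s) ∧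
      ∀ s, s ∉ P → AnalyticAt ℂ F s := by
  classical
  -- The half-plane of absolute convergence may extend beyond Re s > c and contain points of P,
  -- where the value of G is arbitrary; there the value of the series is used instead.
  set F : ℂ → ℂ := fun s => if LSeries.abscissaOfAbsConv f < s.re then LSeries f s else G s with hF
  have key : ∀ s, s ∉ P → F s = G s := by
    intro s hs
    by_cases hsU : LSeries.abscissaOfAbsConv f < s.re
    · have hz₀ : LSeries.abscissaOfAbsConv f < (((c + 1 : ℝ) : ℂ)).re := by
        refine hf.trans_lt ?_
        rw [ofReal_re]
        exact_mod_cast lt_add_one c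
      have hnear : LSeries f =ᶠ[𝓝 ((c + 1 : ℝ) : ℂ)] G := by
        have : ∀ᶠ z : ℂ in 𝓝 ((c + 1 : ℝ) : ℂ), c < z.re :=
          (isOpen_lt continuous_const continuous_re).mem_nhds (by simp)
        filter_upwards [this] with z hz using (hG z hz).symm
      have hL := LSeries_analyticOnNhd f
      have := eventuallyEq_nhdsNE_of_isPreconnected (isPreconnected_lt_re_EReal _)
        hL.meromorphicOn (fun z _ => hmer z) hz₀ hsU (hnear.filter_mono nhdsWithin_le_nhds)
      simp only [hF, if_pos hsU]
      exact (AnalyticAt.eventuallyEq_nhds_of_nhdsNE (hL s hsU) (han s hs) this).eq_of_nhds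
    · simp only [hF, if_neg hsU]
  refine ⟨F, fun s => (hmer s).congr ?_, fun s hs => if_pos hs, fun s hs => (han s hs).congr ?_⟩
  · filter_upwards [hP s] with w hw using (key w hw).symm
  · filter_upwards [eventually_nhdsWithin_iff.1 (hP s)] with w hw
    by_cases hws : w = s
    · exact (key w (hws ▸ hs)).symm
    · exact (key w (hw hws)).symm

end PiltzDivisor

/-- For every `k ≥ 1` the Dirichlet series `D_k(s) = ∑_{n ≥ 1} Δ_k(n) n^{-s}` converges absolutely
for `Re s > 2`, and there is a meromorphic function `F` on the whole complex plane which equals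
`D_k` on its entire open half-plane of absolute convergence and is holomorphic at every point other
than `1, 0, -1, -2, …`. -/
theorem theorem1 (k : ℕ) (hk : 1 ≤ k) :
    LSeries.abscissaOfAbsConv (fun n : ℕ => PiltzDivisor.Delta k (n : ℝ)) ≤ 2 ∧
    ∃ F : ℂ → ℂ, Meromorphic F ∧
      (∀ s : ℂ, LSeries.abscissaOfAbsConv (fun n : ℕ => PiltzDivisor.Delta k (n : ℝ)) < s.re →
        F s = LSeries (fun n : ℕ => PiltzDivisor.Delta k (n : ℝ)) s) ∧
      (∀ s : ℂ, (∀ m : ℕ, s ≠ 1 - (m : ℂ)) → AnalyticAt ℂ F s) := by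
  refine ⟨PiltzDivisor.abscissaOfAbsConv_Delta_le k, ?_⟩
  obtain ⟨G, hmer, han, hG⟩ := PiltzDivisor.exists_meromorphic_continuation k
  have h4 : LSeries.abscissaOfAbsConv (fun n : ℕ => PiltzDivisor.Delta k (n : ℝ)) ≤ (4 : ℝ) :=
    (PiltzDivisor.abscissaOfAbsConv_Delta_le k).trans
      (EReal.coe_le_coe_iff.2 (by norm_num : (2 : ℝ) ≤ 4))
  obtain ⟨F, hF, hFL, hFan⟩ := PiltzDivisor.exists_meromorphic_eq_LSeries
    PiltzDivisor.eventually_ne_one_sub_natCast h4 hmer han hG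
  exact ⟨F, hF, hFL, fun s hs => hFan s fun ⟨m, hm⟩ => hs m hm⟩
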